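/- **Theorem (Conservativity of $\mathrm{CL}^{\mathrm{FI}}$ over $\mathrm{CL}$).** Let $N=\{1,\dots,n\}$ be a finite set of agents and let $\mathrm{Prop}$ be a countable set of atomic propositions. The language $\mathcal L_{\mathrm{CL}}$ of Coalition Logic is generated by $$\varphi ::= p \mid \neg\varphi \mid (\varphi\wedge\varphi) \mid [C]\varphi ,$$ and the language $\mathcal L_{\mathrm{CL}^{\mathrm{FI}}}$ by $$\varphi ::= p \mid \neg\varphi \mid (\varphi\wedge\varphi) \mid [C]\varphi \mid \mathrm{FI}_C(\varphi),$$ where $p\in\mathrm{Prop}$ and $C\subseteq N$; thus $\mathcal L_{\mathrm{CL}}\subseteq\mathcal L_{\mathrm{CL}^{\mathrm{FI}}}$. The connectives $\to$ and $\leftrightarrow$ are the usual abbreviations, $\bot$ stands for any formula $\varphi\wedge\neg\varphi$, and $\top$ for $\neg\bot$. The proof system $\mathrm{CL}$ over $\mathcal L_{\mathrm{CL}}$ has as axioms - all substitution instances of propositional tautologies, - $\neg[C]\bot$ and $[C]\top$, for all $C\subseteq N$, - $([C]\varphi\wedge[D]\psi)\to[C\cup D](\varphi\wedge\psi)$, for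 all $C,D\subseteq N$ with $C\cap D=\emptyset$, - $\neg[\emptyset]\neg\varphi\to[N]\varphi$, and as rules modus ponens, outcome monotonicity (from $\varphi\to\psi$ infer $[C]\varphi\to[C]\psi$) and replacement of equivalents (from $\varphi\leftrightarrow\psi$ infer $[C]\varphi\leftrightarrow[C]\psi$). The proof system $\mathrm{CL}^{\mathrm{FI}}$ has the same axiom schemes and rules, over all formulas of $\mathcal L_{\mathrm{CL}^{\mathrm{FI}}}$, together with the axiom scheme $$\mathrm{FI}_C(\varphi)\leftrightarrow(\neg[C]\varphi\wedge\neg[C]\neg\varphi).$$ Then for every formula $\varphi\in\mathcal L_{\mathrm{CL}}$, $$\vdash_{\mathrm{CL}^{\mathrm{FI}}}\varphi\quad\Longleftrightarrow\quad\vdash_{\mathrm{CL}}\varphi .$$ -/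

import Mathlib

/-- Coalitions are the subsets of the finite set of agents. -/
abbrev Coalition (n : ℕ) : Type := Set (Fin n)

/-- The language of Coalition Logic: `φ ::= p | ¬φ | (φ ∧ ψ) | [C]φ`. -/
inductive CLFormula (n : ℕ) (Atom : Type*) where
  | atom (p : Atom)
  | neg (φ : CLFormula n Atom)
  | and (φ ψ : CLFormula n Atom)
  | eff (C : Coalition n) (φ : CLFormula n Atom)

namespace CLFormula

variable {n : ℕ} {Atom : Type*}

/-- `φ → ψ`, the abbreviation `¬(φ ∧ ¬ψ)`. -/
def imp (φ ψ : CLFormula n Atom) : CLFormula n Atom := neg (and φ (neg ψ))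

/-- `φ ↔ ψ`, the abbreviation `(φ → ψ) ∧ (ψ → φ)`. -/
def iff (φ ψ : CLFormula n Atom) : CLFormula n Atom := and (imp φ ψ) (imp ψ φ)

/-- The contradiction `φ ∧ ¬φ`. The language has no primitive `⊥`; any of these serves as `⊥`. -/
def falsum (φ : CLFormula n Atom) : CLFormula n Atom := and φ (neg φ)

/-- `⊤`, the negation of `⊥`. -/
def verum (φ : CLFormula n Atom) : CLFormula n Atom := neg (falsum φ)

/-- Boolean evaluation, where atoms and formulas that start with a modality get their
truth values from `v`. -/
def boolEval (v : CLFormula n Atom → Prop) : CLFormula n Atom → Prop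
  | atom p => v (atom p)
  | neg φ => ¬ boolEval v φ
  | and φ ψ => boolEval v φ ∧ boolEval v ψ
  | eff C φ => v (eff C φ)

/-- `φ` is a substitution instance of a propositional tautology. -/
def IsTautology (φ : CLFormula n Atom) : Prop := ∀ v, boolEval v φ

end CLFormula

open CLFormula in
/-- Derivability in Coalition Logic. -/
inductive CLProvable {n : ℕ} {Atom : Type*} : CLFormula n Atom → Prop
  /-- Propositional tautologies. -/
  | pl (φ : CLFormula n Atom) : IsTautology φ → CLProvable φ
  /-- `¬[C]⊥`. -/
  | bot (C : Coalition n) (φ : CLFormula n Atom) : CLProvable (neg (eff C (falsum φ)))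
  /-- `[C]⊤`. -/
  | top (C : Coalition n) (φ : CLFormula n Atom) : CLProvable (eff C (verum φ))
  /-- Superadditivity `[C]φ ∧ [D]ψ → [C ∪ D](φ ∧ ψ)` for disjoint `C` and `D`. -/
  | superadd (C D : Coalition n) (φ ψ : CLFormula n Atom) : C ∩ D = ∅ →
      CLProvable (imp (and (eff C φ) (eff D ψ)) (eff (C ∪ D) (and φ ψ)))
  /-- Maximality of the grand coalition, `¬[∅]¬φ → [N]φ`. -/
  | maximality (φ : CLFormula n Atom) :
      CLProvable (imp (neg (eff ∅ (neg φ))) (eff Set.univ φ))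
  /-- Outcome monotonicity: from `φ → ψ` infer `[C]φ → [C]ψ`. -/
  | mono (C : Coalition n) (φ ψ : CLFormula n Atom) : CLProvable (imp φ ψ) →
      CLProvable (imp (eff C φ) (eff C ψ))
  /-- Replacement of equivalents: from `φ ↔ ψ` infer `[C]φ ↔ [C]ψ`. -/
  | re (C : Coalition n) (φ ψ : CLFormula n Atom) : CLProvable (iff φ ψ) →
      CLProvable (iff (eff C φ) (eff C ψ))
  /-- Modus ponens. -/
  | mp (φ ψ : CLFormula n Atom) : CLProvable (imp φ ψ) → CLProvable φ → CLProvable ψ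

/-- The language with Full Inability as a primitive modality:
`φ ::= p | ¬φ | (φ ∧ ψ) | [C]φ | FI_C(φ)`. -/
inductive CLFIFormula (n : ℕ) (Atom : Type*) where
  | atom (p : Atom)
  | neg (φ : CLFIFormula n Atom)
  | and (φ ψ : CLFIFormula n Atom)
  | eff (C : Coalition n) (φ : CLFIFormula n Atom)
  | fi (C : Coalition n) (φ : CLFIFormula n Atom)

namespace CLFIFormula

variable {n : ℕ} {Atom : Type*}

/-- `φ → ψ`, the abbreviation `¬(φ ∧ ¬ψ)`. -/
def imp (φ ψ : CLFIFormula n Atom) : CLFIFormula n Atom := neg (and φ (neg ψ))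

/-- `φ ↔ ψ`, the abbreviation `(φ → ψ) ∧ (ψ → φ)`. -/
def iff (φ ψ : CLFIFormula n Atom) : CLFIFormula n Atom := and (imp φ ψ) (imp ψ φ)

/-- The contradiction `φ ∧ ¬φ`. The language has no primitive `⊥`; any of these serves as `⊥`. -/
def falsum (φ : CLFIFormula n Atom) : CLFIFormula n Atom := and φ (neg φ)

/-- `⊤`, the negation of `⊥`. -/
def verum (φ : CLFIFormula n Atom) : CLFIFormula n Atom := neg (falsum φ)

/-- Boolean evaluation, where atoms and formulas that start with a modality get their
truth values from `v`. -/
def boolEval (v : CLFIFormula n Atom → Prop) : CLFIFormula n Atom → Prop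
  | atom p => v (atom p)
  | neg φ => ¬ boolEval v φ
  | and φ ψ => boolEval v φ ∧ boolEval v ψ
  | eff C φ => v (eff C φ)
  | fi C φ => v (fi C φ)

/-- `φ` is a substitution instance of a propositional tautology. -/
def IsTautology (φ : CLFIFormula n Atom) : Prop := ∀ v, boolEval v φ

end CLFIFormula

open CLFIFormula in
/-- Derivability in Coalition Logic with Full Inability: the axioms and rules of Coalition Logic
over the extended language, together with the definitional axiom for `FI`. -/
inductive CLFIProvable {n : ℕ} {Atom : Type*} : CLFIFormula n Atom → Prop
  /-- Propositional tautologies. -/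
  | pl (φ : CLFIFormula n Atom) : IsTautology φ → CLFIProvable φ
  /-- `¬[C]⊥`. -/
  | bot (C : Coalition n) (φ : CLFIFormula n Atom) : CLFIProvable (neg (eff C (falsum φ)))
  /-- `[C]⊤`. -/
  | top (C : Coalition n) (φ : CLFIFormula n Atom) : CLFIProvable (eff C (verum φ))
  /-- Superadditivity `[C]φ ∧ [D]ψ → [C ∪ D](φ ∧ ψ)` for disjoint `C` and `D`. -/
  | superadd (C D : Coalition n) (φ ψ : CLFIFormula n Atom) : C ∩ D = ∅ →
      CLFIProvable (imp (and (eff C φ) (eff D ψ)) (eff (C ∪ D) (and φ ψ)))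
  /-- Maximality of the grand coalition, `¬[∅]¬φ → [N]φ`. -/
  | maximality (φ : CLFIFormula n Atom) :
      CLFIProvable (imp (neg (eff ∅ (neg φ))) (eff Set.univ φ))
  /-- Outcome monotonicity: from `φ → ψ` infer `[C]φ → [C]ψ`. -/
  | mono (C : Coalition n) (φ ψ : CLFIFormula n Atom) : CLFIProvable (imp φ ψ) →
      CLFIProvable (imp (eff C φ) (eff C ψ))
  /-- Replacement of equivalents: from `φ ↔ ψ` infer `[C]φ ↔ [C]ψ`. -/
  | re (C : Coalition n) (φ ψ : CLFIFormula n Atom) : CLFIProvable (iff φ ψ) →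
      CLFIProvable (iff (eff C φ) (eff C ψ))
  /-- Modus ponens. -/
  | mp (φ ψ : CLFIFormula n Atom) : CLFIProvable (imp φ ψ) → CLFIProvable φ → CLFIProvable ψ
  /-- `FI_C(φ) ↔ (¬[C]φ ∧ ¬[C]¬φ)`. -/
  | defFI (C : Coalition n) (φ : CLFIFormula n Atom) :
      CLFIProvable (iff (fi C φ) (and (neg (eff C φ)) (neg (eff C (neg φ)))))

/-- A formula of Coalition Logic, read as the same formula of the extended language. -/
def CLFormula.toCLFI {n : ℕ} {Atom : Type*} : CLFormula n Atom → CLFIFormula n Atom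
  | .atom p => .atom p
  | .neg φ => .neg φ.toCLFI
  | .and φ ψ => .and φ.toCLFI ψ.toCLFI
  | .eff C φ => .eff C φ.toCLFI

/-! The argument is purely syntactic: `FI` is definable, so unfolding it everywhere turns an
extended derivation into a derivation in Coalition Logic, step by step. The translation commutes
with the connectives and with `[C]`, so instances of the shared axioms and rules go to instances of
the same ones, and the defining axiom for `FI` collapses to `χ ↔ χ`. `FI`-free formulas are left
fixed, which gives conservativity. -/

/-- The translation that unfolds `FI_C(φ)` to `¬[C]φ ∧ ¬[C]¬φ`. -/
def CLFIFormula.toCL {n : ℕ} {Atom : Type*} : CLFIFormula n Atom → CLFormula n Atom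
  | .atom p => .atom p
  | .neg φ => .neg φ.toCL
  | .and φ ψ => .and φ.toCL ψ.toCL
  | .eff C φ => .eff C φ.toCL
  | .fi C φ => .and (.neg (.eff C φ.toCL)) (.neg (.eff C (.neg φ.toCL)))

theorem CLFormula.toCL_toCLFI {n : ℕ} {Atom : Type*} (φ : CLFormula n Atom) :
    φ.toCLFI.toCL = φ := by
  induction φ <;> simp_all [CLFormula.toCLFI, CLFIFormula.toCL]

theorem CLFormula.boolEval_toCLFI {n : ℕ} {Atom : Type*} (v : CLFIFormula n Atom → Prop)
    (φ : CLFormula n Atom) :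
    φ.toCLFI.boolEval v ↔ φ.boolEval (fun ψ => v ψ.toCLFI) := by
  induction φ <;> simp_all [CLFormula.toCLFI, CLFIFormula.boolEval, CLFormula.boolEval]

/-- An `FI` formula is opaque to Boolean evaluation but unfolds to a conjunction, so the pulled-back
valuation must evaluate the unfolding, not merely apply `v` to it. -/
theorem CLFIFormula.boolEval_toCL {n : ℕ} {Atom : Type*} (v : CLFormula n Atom → Prop)
    (φ : CLFIFormula n Atom) :
    φ.toCL.boolEval v ↔ φ.boolEval (fun ψ => ψ.toCL.boolEval v) := by
  induction φ <;> simp_all [CLFIFormula.toCL, CLFIFormula.boolEval, CLFormula.boolEval]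

theorem CLFormula.isTautology_iff_self {n : ℕ} {Atom : Type*} (φ : CLFormula n Atom) :
    (φ.iff φ).IsTautology := by
  intro v
  simp [CLFormula.iff, CLFormula.imp, CLFormula.boolEval]

/-- Every theorem of Coalition Logic is a theorem of the extended system. -/
theorem CLProvable.toCLFI {n : ℕ} {Atom : Type*} {φ : CLFormula n Atom} (h : CLProvable φ) :
    CLFIProvable φ.toCLFI := by
  induction h with
  | pl φ h => exact .pl _ fun v => (φ.boolEval_toCLFI v).2 (h _)
  | bot C φ => exact .bot C _
  | top C φ => exact .top C _
  | superadd C D φ ψ h => exact .superadd C D _ _ h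
  | maximality φ => exact .maximality _
  | mono C φ ψ _ ih => exact .mono C _ _ ih
  | re C φ ψ _ ih => exact .re C _ _ ih
  | mp φ ψ _ _ ih₁ ih₂ => exact .mp _ _ ih₁ ih₂

/-- Unfolding `FI` turns theorems of the extended system into theorems of Coalition Logic. -/
theorem CLFIProvable.toCL {n : ℕ} {Atom : Type*} {φ : CLFIFormula n Atom}
    (h : CLFIProvable φ) : CLProvable φ.toCL := by
  induction h with
  | pl φ h => exact .pl _ fun v => (φ.boolEval_toCL v).2 (h _)
  | bot C φ => exact .bot C _
  | top C φ => exact .top C _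
  | superadd C D φ ψ h => exact .superadd C D _ _ h
  | maximality φ => exact .maximality _
  | mono C φ ψ _ ih => exact .mono C _ _ ih
  | re C φ ψ _ ih => exact .re C _ _ ih
  | mp φ ψ _ _ ih₁ ih₂ => exact .mp _ _ ih₁ ih₂
  -- Both sides of the axiom have the same unfolding by definition.
  | defFI C φ => exact .pl _ (CLFIFormula.toCL (.fi C φ)).isTautology_iff_self

theorem mainTheorem2 {n : ℕ} {Atom : Type*} (φ : CLFormula n Atom) :
    CLFIProvable φ.toCLFI ↔ CLProvable φ :=
  ⟨fun h => φ.toCL_toCLFI ▸ h.toCL, CLProvable.toCLFI⟩
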